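/- Let $m\ge 1$, $n\ge 0$, and let $J_1,\dots,J_m:\mathbb{R}^n\to\,]-\infty,+\infty]$ be proper, convex and lower semicontinuous. Let $\mathcal H=(\mathbb{R}^n)^m$ with $\langle \boldsymbol x,\boldsymbol y\rangle=\sum_{i=1}^m\langle x_i,y_i\rangle$, let $\mathcal S=\{\boldsymbol x\in\mathcal H: x_1=\dots=x_m\}$, $\boldsymbol C(x)=(x,\dots,x)\in\mathcal S$, $\boldsymbol J(\boldsymbol x)=\sum_{i=1}^m J_i(x_i)$, and let $\boldsymbol G$ be the indicator function of $\mathcal S$ ($0$ on $\mathcal S$, $+\infty$ elsewhere). For $\gamma>0$ write $\operatorname{prox}_{\gamma F}(w)=\operatorname{argmin}_u\{\gamma F(u)+\tfrac12\|u-w\|^2\}$. Fix $\gamma\in\,]0,+\infty[$ and $\boldsymbol z_0\in\mathcal H$, let $\boldsymbol x_0=\operatorname{prox}_{\gamma\boldsymbol J}(\boldsymbol z_0)$, and let $(\boldsymbol z_k,\boldsymbol x_k,\boldsymbol v_k)$ be generated by the stationary, unrelaxed ($\lambda_k\equiv 1$) Douglas–Rachford iteration $$\boldsymbol v_{k+1}=\operatorname{prox}_{\gamma\boldsymbol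 G}(2\boldsymbol x_k-\boldsymbol z_k),\qquad \boldsymbol z_{k+1}=\boldsymbol z_k+\boldsymbol v_{k+1}-\boldsymbol x_k,\qquad \boldsymbol x_{k+1}=\operatorname{prox}_{\gamma\boldsymbol J}(\boldsymbol z_{k+1}).$$ Suppose that $(\boldsymbol z_k,\boldsymbol x_k,\boldsymbol v_k)\to(\boldsymbol z^\star,\boldsymbol C(x^\star),\boldsymbol C(x^\star))$ for some $\boldsymbol z^\star\in\mathcal H$ and $x^\star\in\mathbb{R}^n$, and that every $J_i$ is differentiable at $x^\star$ (in particular finite near $x^\star$) and locally polyhedral around $x^\star$, i.e. it coincides on a neighbourhood of $x^\star$ with a function whose epigraph is a finite intersection of closed half-spaces. Then $\boldsymbol z_k,\boldsymbol x_k,\boldsymbol v_k$ and $\frac1m\sum_{i=1}^m\boldsymbol x_{k,i}$ converge in finitely many steps to $\boldsymbol z^\star,\boldsymbol C(x^\star),\boldsymbol C(x^\star),x^\star$: there is $K\in\mathbb{N}$ such that for all $k\ge K$ $$\boldsymbol z_k=\boldsymbol z^\star,\qquad \boldsymbol x_k=\boldsymbol v_k=\boldsymbol C(x^\star),\qquad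 \frac1m\sum_{i=1}^m\boldsymbol x_{k,i}=x^\star.$$ -/

import Mathlib

open Filter Topology

noncomputable section

namespace DRSplit

/-- The epigraph of an extended-real-valued function. -/
def epigraph {E : Type*} (F : E → EReal) : Set (E × ℝ) :=
  {p | F p.1 ≤ (p.2 : EReal)}

/-- The class of proper convex lower semicontinuous functions with values in `(-∞, +∞]`. -/
structure IsGammaZero {E : Type*} [NormedAddCommGroup E] [InnerProductSpace ℝ E]
    (F : E → EReal) : Prop where
  ne_bot : ∀ u, F u ≠ ⊥
  exists_ne_top : ∃ u, F u ≠ ⊤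
  convex : Convex ℝ (epigraph F)
  lsc : LowerSemicontinuous F

/-- A polyhedral set: a finite intersection of closed half-spaces. -/
def IsPolyhedralSet {E : Type*} [AddCommGroup E] [Module ℝ E] (P : Set E) : Prop :=
  ∃ (N : ℕ) (a : Fin N → E →ₗ[ℝ] ℝ) (b : Fin N → ℝ), P = {u | ∀ j, a j u ≤ b j}

/-- A polyhedral function: its epigraph is a polyhedral set. -/
def IsPolyhedralFun {E : Type*} [AddCommGroup E] [Module ℝ E] (F : E → EReal) : Prop :=
  IsPolyhedralSet (epigraph F)

/-- `F` is locally polyhedral around `x`: it coincides with a polyhedral function on a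
neighbourhood of `x`. -/
def IsLocallyPolyhedralAt {E : Type*} [NormedAddCommGroup E] [InnerProductSpace ℝ E]
    (F : E → EReal) (x : E) : Prop :=
  ∃ P : E → EReal, IsPolyhedralFun P ∧ F =ᶠ[𝓝 x] P

/-- Differentiability of an extended-real-valued function at `x`: it is finite on a neighbourhood
of `x`, and the real-valued function it is there is differentiable at `x`. -/
def IsDifferentiableAt {E : Type*} [NormedAddCommGroup E] [InnerProductSpace ℝ E]
    (F : E → EReal) (x : E) : Prop :=
  (∀ᶠ u in 𝓝 x, F u ≠ ⊥ ∧ F u ≠ ⊤) ∧ DifferentiableAt ℝ (fun u => (F u).toReal) x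

/-- `p = prox_{γF}(w)`, i.e. `p` minimizes `u ↦ γ F(u) + ‖u - w‖² / 2`. (For `F` proper, convex and
lower semicontinuous and `γ > 0` there is exactly one such `p`.) -/
def IsProx {E : Type*} [NormedAddCommGroup E] [InnerProductSpace ℝ E]
    (γ : ℝ) (F : E → EReal) (w p : E) : Prop :=
  ∀ u : E, (γ : EReal) * F p + ((‖p - w‖ ^ 2 / 2 : ℝ) : EReal)
    ≤ (γ : EReal) * F u + ((‖u - w‖ ^ 2 / 2 : ℝ) : EReal)

/-- The Douglas-Rachford iteration for `G + J`, with step sizes `γ k` and relaxation parameters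
`lam k`. The starting point `z 0` is arbitrary; the value `v 0` is not used by the iteration. -/
structure IsDouglasRachford {E : Type*} [NormedAddCommGroup E] [InnerProductSpace ℝ E]
    (γ lam : ℕ → ℝ) (G J : E → EReal) (z x v : ℕ → E) : Prop where
  x_zero : IsProx (γ 0) J (z 0) (x 0)
  v_succ : ∀ k, IsProx (γ k) G ((2 : ℝ) • x k - z k) (v (k + 1))
  z_succ : ∀ k, z (k + 1) = (1 - lam k) • z k + lam k • (z k + v (k + 1) - x k)
  x_succ : ∀ k, IsProx (γ (k + 1)) J (z (k + 1)) (x (k + 1))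

/-- The product space `ℝⁿ × ⋯ × ℝⁿ` (`m` factors) with `⟪x, y⟫ = ∑ i, ⟪x i, y i⟫`. -/
abbrev ProdSpace (m n : ℕ) : Type :=
  PiLp 2 (fun _ : Fin m => EuclideanSpace ℝ (Fin n))

/-- The diagonal embedding `x ↦ (x, …, x)`. -/
def diag (m : ℕ) {n : ℕ} (x : EuclideanSpace ℝ (Fin n)) : ProdSpace m n :=
  WithLp.toLp 2 (fun _ => x)

/-- The diagonal subspace `{x : x₁ = ⋯ = xₘ}`. -/
def diagSet (m n : ℕ) : Set (ProdSpace m n) :=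
  {x | ∀ i j, x i = x j}

open Classical in
/-- The indicator function of a set: `0` on the set and `+∞` outside. -/
def indicatorFun {E : Type*} (S : Set E) (u : E) : EReal :=
  if u ∈ S then 0 else ⊤

/-- The separable sum `x ↦ ∑ i, J i (x i)` on the product space. -/
def separableSum {m n : ℕ} (J : Fin m → EuclideanSpace ℝ (Fin n) → EReal)
    (x : ProdSpace m n) : EReal :=
  ∑ i, J i (x i)

/-- The average `(1/m) ∑ i, x i` of the components of a point of the product space. -/
def average {m n : ℕ} (x : ProdSpace m n) : EuclideanSpace ℝ (Fin n) :=
  (1 / (m : ℝ)) • ∑ i, x i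

end DRSplit

end

namespace DRSplit

open scoped RealInnerProductSpace

section Hilbert

variable {E : Type*} [NormedAddCommGroup E] [InnerProductSpace ℝ E]

/-! Convexity, local polyhedrality and differentiability force each `J i` to be affine near the
limit (`eventually_eq_affine`), hence so is the separable sum, with some gradient `g`. Once `x k` is
close to its limit, the prox of `J` is a translation: `z k = x k + γ • g`. The update of `z` then
reads `x (k+1) = v (k+1)`, which lies in the diagonal `S`. Passing to the limit in the optimality
condition of the projection onto `S` gives `g ⊥ S`, so projecting `2 x k - z k = x k - γ • g`
returns `x k`. The iteration is therefore eventually constant, and the constant is the limit. -/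

lemma eq_zero_of_eventually_nonneg_quadratic {a b : ℝ}
    (h : ∀ᶠ t : ℝ in 𝓝 0, 0 ≤ t * a + t ^ 2 * b) : a = 0 := by
  have hmin : IsLocalMin (fun t : ℝ => t * a + t ^ 2 * b) 0 := by
    filter_upwards [h] with t ht
    simpa using ht
  have hd : HasDerivAt (fun t : ℝ => t * a + t ^ 2 * b) a 0 := by
    have h' := ((hasDerivAt_id (0 : ℝ)).mul_const a).add
      (((hasDerivAt_id (0 : ℝ)).pow 2).mul_const b)
    exact h'.congr_deriv (by simp)
  exact hmin.hasDerivAt_eq_zero hd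

/-- A real-valued differentiable function lying below the graph of a chord has its derivative below
the slope of that chord. -/
lemma fderiv_apply_le_of_segment {f : E → ℝ} {L : E →L[ℝ] ℝ} {x h : E} {s : ℝ}
    (hf : HasFDerivAt f L x)
    (hle : ∀ᶠ t : ℝ in 𝓝[>] 0, f (x + t • h) ≤ f x + t * s) : L h ≤ s := by
  have hline : HasDerivAt (fun t : ℝ => f (x + t • h)) (L h) 0 := hf.hasLineDerivAt h
  have ht := (hasDerivWithinAt_iff_tendsto_slope' (Set.self_notMem_Ioi (a := (0 : ℝ)))).1
    hline.hasDerivWithinAt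
  refine le_of_tendsto ht ?_
  filter_upwards [hle, self_mem_nhdsWithin] with t h1 h2
  have h2' : (0 : ℝ) < t := h2
  rw [slope_def_field, div_le_iff₀ (by simpa using h2')]
  simp only [zero_smul, add_zero, sub_zero]
  linarith

/-- The tangent plane supports the epigraph globally: `F` lies below its chords from `x`, so the
chord slope bounds the derivative. Finiteness is needed only near `x`. -/
lemma le_of_convex_epigraph {F : E → EReal} (hF : Convex ℝ (epigraph F)) {x : E}
    (hfin : ∀ᶠ u in 𝓝 x, F u ≠ ⊥ ∧ F u ≠ ⊤) {L : E →L[ℝ] ℝ}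
    (hL : HasFDerivAt (fun u => (F u).toReal) L x) {u : E} {r : ℝ} (hu : F u ≤ r) :
    (F x).toReal + L (u - x) ≤ r := by
  have hx := hfin.self_of_nhds
  suffices L (u - x) ≤ r - (F x).toReal by linarith
  refine fderiv_apply_le_of_segment hL ?_
  have hcont : Tendsto (fun t : ℝ => x + t • (u - x)) (𝓝[>] 0) (𝓝 x) := by
    have : Continuous (fun t : ℝ => x + t • (u - x)) := by fun_prop
    have h0 := this.tendsto 0
    simp only [zero_smul, add_zero] at h0
    exact h0.mono_left nhdsWithin_le_nhds
  filter_upwards [hcont.eventually hfin, Ioo_mem_nhdsGT (zero_lt_one (α := ℝ))] with t ht ht01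
  have hmem : (x, (F x).toReal) ∈ epigraph F := by
    simp [epigraph, EReal.coe_toReal hx.2 hx.1]
  have hmem' : (u, r) ∈ epigraph F := hu
  have key := hF hmem hmem' (sub_nonneg.2 ht01.2.le) ht01.1.le (by ring)
  have key' : F ((1 - t) • x + t • u) ≤ (((1 - t) * (F x).toReal + t * r : ℝ) : EReal) := key
  have e : (1 - t) • x + t • u = x + t • (u - x) := by module
  rw [e, ← EReal.coe_toReal ht.2 ht.1, EReal.coe_le_coe_iff] at key'
  linarith

/-- A convex function that is locally polyhedral and differentiable at a point is affine
near that point. -/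
theorem eventually_eq_affine [FiniteDimensional ℝ E] {F : E → EReal} {x : E}
    (hF : Convex ℝ (epigraph F)) (hpoly : IsLocallyPolyhedralAt F x)
    (hdiff : IsDifferentiableAt F x) :
    ∃ (g : E) (c : ℝ), ∀ᶠ u in 𝓝 x, F u = ((c + ⟪g, u⟫ : ℝ) : EReal) := by
  obtain ⟨P, ⟨N, a, b, hP⟩, hFP⟩ := hpoly
  obtain ⟨hfin, hd⟩ := hdiff
  set f : E → ℝ := fun u => (F u).toReal with hf
  set L := fderiv ℝ f x
  have hL : HasFDerivAt f L x := hd.hasFDerivAt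
  have hfF : ∀ᶠ u in 𝓝 x, F u = (f u : EReal) :=
    hfin.mono fun u hu => (EReal.coe_toReal hu.2 hu.1).symm
  have hmem : ∀ u r, P u ≤ ((r : ℝ) : EReal) ↔ ∀ j, a j (u, r) ≤ b j := fun u r => by
    have : (u, r) ∈ epigraph P ↔ (u, r) ∈ {u | ∀ j, a j u ≤ b j} := by rw [hP]
    exact this
  have hgraph : ∀ᶠ u in 𝓝 x, ∀ j, a j (u, f u) ≤ b j := by
    filter_upwards [hFP, hfF] with u h1 h2
    rw [← hmem, ← h1, h2]
  have haffine : HasFDerivAt (fun u => (u, f x + L (u - x)))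
      ((ContinuousLinearMap.id ℝ E).prod L) x := by
    refine (hasFDerivAt_id x).prodMk ?_
    simpa using (L.hasFDerivAt.comp x ((hasFDerivAt_id x).sub_const x)).const_add (f x)
  have hupper : ∀ᶠ u in 𝓝 x, ∀ j, a j (u, f x + L (u - x)) ≤ b j := by
    rw [eventually_all]
    intro j
    let A : E × ℝ →L[ℝ] ℝ := LinearMap.toContinuousLinearMap (a j)
    -- An inactive constraint survives by continuity. An active one is maximal along the graph at
    -- `x`, so its derivative there vanishes and it is constant on the tangent plane.
    rcases (hgraph.self_of_nhds j).lt_or_eq with hlt | heq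
    · have hc : ContinuousAt (fun u => A (u, f x + L (u - x))) x := by fun_prop
      have : A (x, f x + L (x - x)) < b j := by simpa [A] using hlt
      exact (hc.eventually_lt continuousAt_const this).mono fun u hu => hu.le
    · have hmax : IsLocalMax (fun u => A (u, f u)) x := by
        filter_upwards [hgraph] with u hu
        exact (hu j).trans heq.ge
      have hder := A.hasFDerivAt.comp x ((hasFDerivAt_id x).prodMk hL)
      have hzero := hmax.hasFDerivAt_eq_zero hder
      refine Eventually.of_forall fun u => le_of_eq ?_
      have h0 : A (u - x, L (u - x)) = 0 := by
        simpa using DFunLike.congr_fun hzero (u - x)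
      have e : (u, f x + L (u - x)) = (x, f x) + (u - x, L (u - x)) := by simp
      rw [e, map_add, heq]
      exact add_eq_left.2 h0
  refine ⟨(InnerProductSpace.toDual ℝ E).symm L, f x - L x, ?_⟩
  filter_upwards [hupper, hFP, hfF] with u h1 h2 h3
  have hle : F u ≤ ((f x + L (u - x) : ℝ) : EReal) := by rw [h2, hmem]; exact h1
  -- Polyhedrality put the tangent plane inside the epigraph; convexity puts it below the graph.
  have hge : f x + L (u - x) ≤ f u := le_of_convex_epigraph hF hfin hL h3.le
  rw [h3, EReal.coe_le_coe_iff] at hle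
  rw [h3, InnerProductSpace.toDual_symm_apply, le_antisymm hle hge, map_sub]
  congr 1
  ring

/-- The proximal point is an explicit (gradient) step where the function is affine. -/
lemma IsProx.eq_add_of_affine {F : E → EReal} {γ c : ℝ} {g w p : E}
    (h : IsProx γ F w p) (haff : ∀ᶠ u in 𝓝 p, F u = ((c + ⟪g, u⟫ : ℝ) : EReal)) :
    w = p + γ • g := by
  have key : ∀ d : E, ⟪γ • g + (p - w), d⟫ = 0 := by
    intro d
    -- Comparing `p` with `p + t • d`, for `t` of either sign, leaves a quadratic in `t` whose
    -- linear coefficient is this inner product.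
    refine eq_zero_of_eventually_nonneg_quadratic (b := ‖d‖ ^ 2 / 2) ?_
    have hcont : Tendsto (fun t : ℝ => p + t • d) (𝓝 0) (𝓝 p) := by
      have : Continuous (fun t : ℝ => p + t • d) := by fun_prop
      simpa using this.tendsto 0
    filter_upwards [hcont.eventually haff] with t ht
    have h1 := h (p + t • d)
    rw [ht, haff.self_of_nhds] at h1
    norm_cast at h1
    have e : p + t • d - w = (p - w) + t • d := by abel
    rw [e, norm_add_sq_real, norm_smul, mul_pow, Real.norm_eq_abs, sq_abs, inner_add_right,
      inner_smul_right, inner_smul_right] at h1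
    rw [inner_add_left, inner_smul_left]
    simp only [conj_trivial]
    nlinarith
  have h0 : γ • g + (p - w) = 0 := inner_self_eq_zero.1 (key _)
  rw [← sub_eq_zero, ← neg_eq_zero, ← h0]
  abel

/-- The proximal point of the indicator function of a subspace is the orthogonal projection. -/
lemma IsProx.mem_and_inner_eq_zero {S : Submodule ℝ E} {γ : ℝ} (hγ : 0 < γ) {w p : E}
    (h : IsProx γ (indicatorFun (S : Set E)) w p) :
    p ∈ S ∧ ∀ d ∈ S, ⟪p - w, d⟫ = 0 := by
  have hp : p ∈ S := by
    by_contra hp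
    -- The competitor `0 ∈ S` has finite value, while `p ∉ S` would have value `⊤`.
    have h0 := h 0
    simp [indicatorFun, hp, EReal.coe_mul_top_of_pos hγ] at h0
  refine ⟨hp, fun d hd => ?_⟩
  refine eq_zero_of_eventually_nonneg_quadratic (b := ‖d‖ ^ 2 / 2)
    (Eventually.of_forall fun t => ?_)
  have h1 := h (p + t • d)
  simp only [indicatorFun, SetLike.mem_coe, hp, S.add_mem hp (S.smul_mem t hd), if_true, mul_zero,
    zero_add, EReal.coe_le_coe_iff] at h1
  have e : p + t • d - w = (p - w) + t • d := by abel
  rw [e, norm_add_sq_real, norm_smul, mul_pow, Real.norm_eq_abs, sq_abs, inner_smul_right] at h1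
  linarith

/-- Finite convergence of the stationary unrelaxed Douglas-Rachford iteration, for a subspace and a
function that is affine near the limit. -/
theorem IsDouglasRachford.eventually_eq_of_affine {S : Submodule ℝ E} {γ c : ℝ} (hγ : 0 < γ)
    {J : E → EReal} {z x v : ℕ → E} {zlim xlim g : E}
    (hDR : IsDouglasRachford (fun _ => γ) (fun _ => 1) (indicatorFun (S : Set E)) J z x v)
    (hz : Tendsto z atTop (𝓝 zlim)) (hx : Tendsto x atTop (𝓝 xlim))
    (hv : Tendsto v atTop (𝓝 xlim))
    (haff : ∀ᶠ u in 𝓝 xlim, J u = ((c + ⟪g, u⟫ : ℝ) : EReal)) :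
    ∀ᶠ k in atTop, z k = zlim ∧ x k = xlim ∧ v k = xlim := by
  have hprox : ∀ k, IsProx γ J (z k) (x k)
    | 0 => hDR.x_zero
    | k + 1 => hDR.x_succ k
  -- The prox step needs `J` affine on a neighbourhood of `x k`, not just at `x k`; hence
  -- `eventually_nhds`.
  have hzx : ∀ᶠ k in atTop, z k = x k + γ • g :=
    (hx.eventually haff.eventually_nhds).mono fun k hk => (hprox k).eq_add_of_affine hk
  have hproj := fun k => (hDR.v_succ k).mem_and_inner_eq_zero hγ
  obtain ⟨K, hK⟩ := eventually_atTop.1 hzx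
  have hw : ∀ k ≥ K, v (k + 1) - ((2 : ℝ) • x k - z k) = (v (k + 1) - x k) + γ • g := by
    intro k hk
    rw [hK k hk]
    module
  -- `v (k + 1)` and `x k` share a limit, so only `γ • g` remains in the projection condition.
  have horth : ∀ d ∈ S, ⟪γ • g, d⟫ = 0 := by
    intro d hd
    have hlim : Tendsto (fun k => ⟪(v (k + 1) - x k) + γ • g, d⟫) atTop
        (𝓝 ⟪(xlim - xlim) + γ • g, d⟫) :=
      ((((tendsto_add_atTop_iff_nat 1).2 hv).sub hx).add_const _).inner tendsto_const_nhds
    rw [sub_self, zero_add] at hlim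
    refine tendsto_nhds_unique hlim (tendsto_const_nhds.congr' ?_)
    filter_upwards [eventually_ge_atTop K] with k hk
    rw [← hw k hk, (hproj k).2 d hd]
  have hxv : ∀ k ≥ K, x (k + 1) = v (k + 1) := by
    intro k hk
    have h1 := hDR.z_succ k
    rw [hK k hk, hK (k + 1) (by omega)] at h1
    refine add_right_cancel (b := γ • g) (h1.trans ?_)
    module
  -- The shift to `K + 1` ensures `x k = v k ∈ S`, so `v (k + 1) - x k` is itself an admissible test
  -- direction.
  have hvx : ∀ k ≥ K + 1, v (k + 1) = x k := by
    intro k hk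
    obtain ⟨j, rfl⟩ : ∃ j, k = j + 1 := ⟨k - 1, by omega⟩
    have hmem : v (j + 1 + 1) - x (j + 1) ∈ S := by
      rw [hxv j (by omega)]
      exact S.sub_mem (hproj _).1 (hproj _).1
    have h1 := (hproj (j + 1)).2 _ hmem
    rw [hw _ (by omega), inner_add_left, horth _ hmem, add_zero] at h1
    exact sub_eq_zero.1 (inner_self_eq_zero.1 h1)
  have hconst : ∀ k ≥ K + 1, x k = x (K + 1) := by
    intro k hk
    induction k, hk using Nat.le_induction with
    | base => rfl
    | succ k hk ih => rw [hxv k (by omega), hvx k hk, ih]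
  have hxK : x (K + 1) = xlim := tendsto_nhds_unique
    (tendsto_const_nhds.congr' (eventually_atTop.2 ⟨K + 1, fun k hk => (hconst k hk).symm⟩)) hx
  have hzlim : zlim = xlim + γ • g := tendsto_nhds_unique hz
    ((hx.add_const _).congr' (hzx.mono fun k hk => hk.symm))
  refine eventually_atTop.2 ⟨K + 1, fun k hk => ?_⟩
  have hxk : x k = xlim := (hconst k hk).trans hxK
  refine ⟨by rw [hK k (by omega), hxk, hzlim], hxk, ?_⟩
  obtain ⟨j, rfl⟩ : ∃ j, k = j + 1 := ⟨k - 1, by omega⟩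
  rw [← hxv j (by omega), hxk]

end Hilbert

/-- The diagonal subspace of the product space. -/
def diagSubmodule (m n : ℕ) : Submodule ℝ (ProdSpace m n) where
  carrier := diagSet m n
  add_mem' hx hy i j := by simp [hx i j, hy i j]
  zero_mem' _ _ := rfl
  smul_mem' c _ hx i j := by simp [hx i j]

lemma separableSum_eventually_eq_affine {m n : ℕ} {J : Fin m → EuclideanSpace ℝ (Fin n) → EReal}
    {x : ProdSpace m n} {g : Fin m → EuclideanSpace ℝ (Fin n)} {c : Fin m → ℝ}
    (h : ∀ i, ∀ᶠ u in 𝓝 (x i), J i u = ((c i + ⟪g i, u⟫ : ℝ) : EReal)) :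
    ∀ᶠ u in 𝓝 x, separableSum J u = ((∑ i, c i + ⟪WithLp.toLp 2 g, u⟫ : ℝ) : EReal) := by
  have hall : ∀ᶠ u in 𝓝 x, ∀ i, J i (u i) = ((c i + ⟪g i, u i⟫ : ℝ) : EReal) := by
    rw [eventually_all]
    intro i
    have hc : Continuous fun u : ProdSpace m n => u i := by fun_prop
    exact (hc.tendsto x).eventually (h i)
  filter_upwards [hall] with u hu
  -- As an additive homomorphism, the coercion commutes with finite sums.
  let coeHom : ℝ →+ EReal := ⟨⟨Real.toEReal, EReal.coe_zero⟩, EReal.coe_add⟩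
  rw [PiLp.inner_apply, ← Finset.sum_add_distrib]
  exact (Finset.sum_congr rfl fun i _ => hu i).trans (map_sum coeHom _ _).symm

lemma average_diag {m n : ℕ} (hm : 1 ≤ m) (x : EuclideanSpace ℝ (Fin n)) :
    average (diag m x) = x := by
  have : (m : ℝ) ≠ 0 := by positivity
  simp [average, diag, ← Nat.cast_smul_eq_nsmul ℝ, smul_smul, this]

end DRSplit

theorem corollary8p2 (m n : ℕ) (hm : 1 ≤ m)
    (J : Fin m → EuclideanSpace ℝ (Fin n) → EReal)
    (hJ : ∀ i, DRSplit.IsGammaZero (J i))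
    (γ : ℝ) (hγ : 0 < γ)
    (z x v : ℕ → DRSplit.ProdSpace m n)
    (hDR : DRSplit.IsDouglasRachford (fun _ => γ) (fun _ => 1)
      (DRSplit.indicatorFun (DRSplit.diagSet m n)) (DRSplit.separableSum J) z x v)
    (zstar : DRSplit.ProdSpace m n) (xstar : EuclideanSpace ℝ (Fin n))
    (hz : Tendsto z atTop (𝓝 zstar))
    (hx : Tendsto x atTop (𝓝 (DRSplit.diag m xstar)))
    (hv : Tendsto v atTop (𝓝 (DRSplit.diag m xstar)))
    (hpoly : ∀ i, DRSplit.IsLocallyPolyhedralAt (J i) xstar)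
    (hdiff : ∀ i, DRSplit.IsDifferentiableAt (J i) xstar) :
    ∃ K : ℕ, ∀ k ≥ K, z k = zstar ∧ x k = DRSplit.diag m xstar ∧
      v k = DRSplit.diag m xstar ∧ DRSplit.average (x k) = xstar := by

  choose g c hgc using fun i => DRSplit.eventually_eq_affine (hJ i).convex (hpoly i) (hdiff i)
  have haff := DRSplit.separableSum_eventually_eq_affine (x := DRSplit.diag m xstar) hgc
  obtain ⟨K, hK⟩ := eventually_atTop.1 <| DRSplit.IsDouglasRachford.eventually_eq_of_affine
    (S := DRSplit.diagSubmodule m n) hγ hDR hz hx hv haff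
  refine ⟨K, fun k hk => ?_⟩
  obtain ⟨h1, h2, h3⟩ := hK k hk
  exact ⟨h1, h2, h3, by rw [h2, DRSplit.average_diag hm]⟩
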